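/- Let $k\ge 1$. A $k$-graph $(\Lambda,d)$ is a small category $\Lambda$ with countably many morphisms (called paths, with codomain map $r$ and domain map $s$) and a functor $d:\Lambda\to\mathbb N^k$ such that whenever $d(\lambda)=m+n$ there are unique paths $\mu,\nu$ with $d(\mu)=m$, $d(\nu)=n$ and $\lambda=\mu\nu$. The objects are identified with the paths of degree $0$ and form the set $\Lambda^0$. For paths $\mu,\nu$ let $\mathrm{MCE}(\mu,\nu)$ be the set of paths $\lambda$ with $d(\lambda)=d(\mu)\vee d(\nu)$ (coordinatewise maximum) that factor both as $\mu\alpha$ and as $\nu\beta$, and let $\Lambda^{\min}(\mu,\nu)=\{(\alpha,\beta):\mu\alpha=\nu\beta\in\mathrm{MCE}(\mu,\nu)\}$. $\Lambda$ is finitely aligned if every $\mathrm{MCE}(\mu,\nu)$ is finite. A set $E\subset v\Lambda=\{\lambda: r(\lambda)=v\}$ is exhaustive if for every $\lambda\in v\Lambda$ there are $\nu\in E$ and $\beta$ with $r(\beta)=s(\lambda)$ and $\lambda\beta\in\mathrm{MCE}(\lambda,\nu)$; $\mathrm{FE}(\Lambda)$ is the collection of all finite exhaustive $E\subset v\Lambda\setminus\{v\}$,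 $v\in\Lambda^0$, and $r(E)=v$ for such $E$. For $\mathcal E\subset \mathrm{FE}(\Lambda)$, $C^*(\Lambda;\mathcal E)$ is the universal $C^*$-algebra generated by partial isometries $\{t_\lambda:\lambda\in\Lambda\}$ such that: the $t_v$, $v\in\Lambda^0$, are mutually orthogonal projections; $t_\lambda t_\mu=t_{\lambda\mu}$ if $s(\lambda)=r(\mu)$ and $t_\lambda t_\mu=0$ otherwise; $t_\lambda^*t_\mu=\sum_{(\alpha,\beta)\in\Lambda^{\min}(\lambda,\mu)}t_\alpha t_\beta^*$ for all $\lambda,\mu$; and $\prod_{\lambda\in E}(t_{r(E)}-t_\lambda t_\lambda^*)=0$ for all $E\in\mathcal E$. **Lemma.** Let $(\Lambda,d)$ be a finitely aligned $k$-graph and let $\mathcal E\subset\mathrm{FE}(\Lambda)$. Suppose there is a function $b:\Lambda^0\to\mathbb Z^k$ such that $d(\lambda)=b(s(\lambda))-b(r(\lambda))$ for all $\lambda\in\Lambda$. Then $C^*(\Lambda;\mathcal E)$ is AF, i.e. it is the closure of the union of an increasing sequence of finite-dimensional $C^*$-subalgebras. -/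

import Mathlib

open scoped ENNReal
open CategoryTheory

universe u v w

/-- The set `Mor(Λ)` of all morphisms ("paths") of a category `Λ`; `r` is the codomain and `s` the
domain. -/
@[ext]
structure Mor (Λ : Type u) [Category.{v} Λ] : Type (max u v) where
  {s : Λ}
  {r : Λ}
  hom : s ⟶ r

namespace Mor

variable {Λ : Type u} [Category.{v} Λ]

/-- The identity morphism at `x`, i.e. the vertex `x` regarded as a path. -/
def idMor (x : Λ) : Mor Λ := ⟨𝟙 x⟩

/-- The composite `p q` (first `q`, then `p`), defined when `r(q) = s(p)`. -/
def comp (p q : Mor Λ) (h : q.r = p.s) : Mor Λ := ⟨q.hom ≫ eqToHom h ≫ p.hom⟩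

end Mor

/-- A `k`-graph structure on the (small) category `Λ`: countability of the set of morphisms, and a
degree functor `d : Λ → ℕ^k` (written as a function on morphisms which sends identities to `0` and
composites to sums) with the factorisation property. -/
structure KGraph (k : ℕ) (Λ : Type u) [Category.{v} Λ] where
  countable : Countable (Mor Λ)
  d : Mor Λ → (Fin k → ℕ)
  d_id : ∀ x : Λ, d (Mor.idMor x) = 0
  d_comp : ∀ (p q : Mor Λ) (h : q.r = p.s), d (p.comp q h) = d p + d q
  factorisation : ∀ (l : Mor Λ) (m n : Fin k → ℕ), d l = m + n →
    ∃! pq : Mor Λ × Mor Λ, d pq.1 = m ∧ d pq.2 = n ∧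
      ∃ h : pq.2.r = pq.1.s, l = pq.1.comp pq.2 h

namespace KGraph

variable {k : ℕ} {Λ : Type u} [Category.{v} Λ]

/-- `p` is an initial segment of `l`: `l = p q` for some path `q`. By the factorisation property
this says exactly that `d(p) ≤ d(l)` and `l(0, d(p)) = p`. -/
def IsInitial (p l : Mor Λ) : Prop :=
  ∃ (q : Mor Λ) (h : q.r = p.s), l = p.comp q h

/-- The minimal common extensions of `p` and `q`. -/
def MCE (G : KGraph k Λ) (p q : Mor Λ) : Set (Mor Λ) :=
  {l | G.d l = G.d p ⊔ G.d q ∧ IsInitial p l ∧ IsInitial q l}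

/-- `Λ^min(p, q)`: the pairs `(a, b)` with `p a = q b ∈ MCE(p, q)`. -/
def minExt (G : KGraph k Λ) (p q : Mor Λ) : Set (Mor Λ × Mor Λ) :=
  {ab | ∃ (h : ab.1.r = p.s) (h' : ab.2.r = q.s),
    p.comp ab.1 h = q.comp ab.2 h' ∧ p.comp ab.1 h ∈ G.MCE p q}

/-- `Ext(p; E)`: the `b ∈ s(p)Λ` such that `p b ∈ MCE(p, q)` for some `q ∈ E`. -/
def Ext (G : KGraph k Λ) (p : Mor Λ) (E : Set (Mor Λ)) : Set (Mor Λ) :=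
  {b | ∃ h : b.r = p.s, ∃ q ∈ E, p.comp b h ∈ G.MCE p q}

/-- `Λ` is finitely aligned. -/
def FinitelyAligned (G : KGraph k Λ) : Prop :=
  ∀ p q : Mor Λ, (G.MCE p q).Finite

/-- A subset `E` of `xΛ` is exhaustive. -/
def Exhaustive (G : KGraph k Λ) (x : Λ) (E : Set (Mor Λ)) : Prop :=
  ∀ p : Mor Λ, p.r = x → (G.Ext p E).Nonempty

/-- `FE(Λ)`: the finite exhaustive subsets of `xΛ ∖ {x}`, for `x` a vertex. -/
def FE (G : KGraph k Λ) : Set (Finset (Mor Λ)) :=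
  {E | ∃ x : Λ, (∀ p ∈ E, p.r = x ∧ p ≠ Mor.idMor x) ∧ G.Exhaustive x (E : Set (Mor Λ))}

theorem comp_left_cancel (G : KGraph k Λ) {p a a' : Mor Λ} {h : a.r = p.s} {h' : a'.r = p.s}
    (e : p.comp a h = p.comp a' h') : a = a' := by
  have hd : G.d a' = G.d a := by
    have := congrArg G.d e
    rw [G.d_comp, G.d_comp] at this
    exact (add_left_cancel this).symm
  have := (G.factorisation _ _ _ (G.d_comp p a h)).unique
    (y₁ := (p, a)) (y₂ := (p, a')) ⟨rfl, rfl, h, rfl⟩ ⟨rfl, hd, h', e⟩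
  exact congrArg Prod.snd this

theorem minExt_finite (G : KGraph k Λ) (hG : G.FinitelyAligned) (p q : Mor Λ) :
    (G.minExt p q).Finite := by
  refine ((hG p q).biUnion (t := fun l => {ab : Mor Λ × Mor Λ |
    ∃ (h : ab.1.r = p.s) (h' : ab.2.r = q.s), p.comp ab.1 h = l ∧ q.comp ab.2 h' = l})
    fun l _ => Set.Subsingleton.finite ?_).subset ?_
  · rintro ⟨a, c⟩ ⟨h, h', e, e'⟩ ⟨a', c'⟩ ⟨g, g', f, f'⟩
    exact Prod.ext (G.comp_left_cancel (e.trans f.symm)) (G.comp_left_cancel (e'.trans f'.symm))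
  · rintro ⟨a, c⟩ ⟨h, h', e, hm⟩
    exact Set.mem_biUnion hm ⟨h, h', rfl, e.symm⟩

theorem FE_nonempty (G : KGraph k Λ) {E : Finset (Mor Λ)} (hE : E ∈ G.FE) : E.Nonempty := by
  obtain ⟨x, -, hx⟩ := hE
  obtain ⟨_, _, q, hq, _⟩ := hx (Mor.idMor x) rfl
  exact ⟨q, hq⟩

/-- `t` is a relative Cuntz-Krieger `(Λ; 𝓔)`-family in the C⋆-algebra `B`.
The sum in `tck3` is finite when `Λ` is finitely aligned (`minExt_finite`). In `ck`, the vertex `x`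
is `r(E)` (members of `FE(Λ)` are nonempty), `l` is any enumeration of `E` without repetition (the
factors commute, by `tck3`), and the product is formed in the unitization of `B` only because `B`
has no unit that could serve as the empty product. -/
structure IsRelCKFamily (G : KGraph k Λ) (𝓔 : Set (Finset (Mor Λ)))
    {B : Type w} [NonUnitalCStarAlgebra B] (t : Mor Λ → B) : Prop where
  partialIsometry : ∀ p, t p * star (t p) * t p = t p
  tck1_proj : ∀ x : Λ, IsStarProjection (t (Mor.idMor x))
  tck1_orth : ∀ x y : Λ, x ≠ y → t (Mor.idMor x) * t (Mor.idMor y) = 0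
  tck2_comp : ∀ (p q : Mor Λ) (h : q.r = p.s), t p * t q = t (p.comp q h)
  tck2_zero : ∀ p q : Mor Λ, q.r ≠ p.s → t p * t q = 0
  tck3 : ∀ p q : Mor Λ, star (t p) * t q = ∑ᶠ ab ∈ G.minExt p q, t ab.1 * star (t ab.2)
  ck : ∀ E ∈ 𝓔, ∀ x : Λ, (∀ p ∈ E, p.r = x) →
    ∀ l : List (Mor Λ), l.Nodup → (∀ p, p ∈ l ↔ p ∈ E) →
      (l.map fun p => (Unitization.inr (t (Mor.idMor x) - t p * star (t p)) :
        Unitization ℂ B)).prod = 0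

/-! ### The universal algebra -/

theorem IsRelCKFamily.norm_le {G : KGraph k Λ} {𝓔 : Set (Finset (Mor Λ))}
    {B : Type w} [NonUnitalCStarAlgebra B] {t : Mor Λ → B} (ht : G.IsRelCKFamily 𝓔 t)
    (p : Mor Λ) : ‖t p‖ ≤ 1 := by
  have hp : IsStarProjection (star (t p) * t p) := by
    refine ⟨?_, IsSelfAdjoint.star_mul_self _⟩
    have := ht.partialIsometry p
    unfold IsIdempotentElem
    rw [mul_assoc, ← mul_assoc (t p), this]
  have h1 := hp.norm_le
  rw [CStarRing.norm_star_mul_self] at h1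
  nlinarith [norm_nonneg (t p)]

theorem prod_inr_mem {M : Type*} {B : Type w} [NonUnitalCStarAlgebra B] (f : M → B) (l : List M)
    (hl : l ≠ []) : ∃ a : B, (l.map fun p => (Unitization.inr (f p) : Unitization ℂ B)).prod =
      Unitization.inr a := by
  induction l with
  | nil => exact absurd rfl hl
  | cons p l ih =>
    by_cases h : l = []
    · subst h; exact ⟨f p, by simp⟩
    · obtain ⟨a, ha⟩ := ih h
      refine ⟨f p * a, ?_⟩
      rw [List.map_cons, List.prod_cons, ha, Unitization.inr_mul]

theorem starMap_prod {M : Type*} {A : Type*} {B : Type*} [NonUnitalCStarAlgebra A]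
    [NonUnitalCStarAlgebra B] (φ : A →⋆ₙₐ[ℂ] B) (f : M → A) (l : List M) :
    Unitization.starMap φ (l.map fun p => (Unitization.inr (f p) : Unitization ℂ A)).prod =
      (l.map fun p => (Unitization.inr (φ (f p)) : Unitization ℂ B)).prod := by
  rw [map_list_prod, List.map_map]
  congr 1
  refine List.map_congr_left fun p _ => ?_
  simp only [Function.comp_apply, Unitization.starMap_inr]

theorem IsRelCKFamily.map {G : KGraph k Λ} {𝓔 : Set (Finset (Mor Λ))} (hG : G.FinitelyAligned)
    {A : Type*} {B : Type*} [NonUnitalCStarAlgebra A] [NonUnitalCStarAlgebra B]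
    (φ : A →⋆ₙₐ[ℂ] B) {t : Mor Λ → A} (ht : G.IsRelCKFamily 𝓔 t) :
    G.IsRelCKFamily 𝓔 (fun p => φ (t p)) where
  partialIsometry p := by rw [← map_star, ← map_mul, ← map_mul, ht.partialIsometry]
  tck1_proj x := by
    refine ⟨?_, ?_⟩
    · unfold IsIdempotentElem
      rw [← map_mul, (ht.tck1_proj x).isIdempotentElem.eq]
    · rw [isSelfAdjoint_iff, ← map_star, (ht.tck1_proj x).isSelfAdjoint.star_eq]
  tck1_orth x y h := by rw [← map_mul, ht.tck1_orth x y h, map_zero]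
  tck2_comp p q h := by rw [← map_mul, ht.tck2_comp p q h]
  tck2_zero p q h := by rw [← map_mul, ht.tck2_zero p q h, map_zero]
  tck3 p q := by
    rw [← map_star, ← map_mul, ht.tck3, finsum_mem_eq_finite_toFinset_sum _ (G.minExt_finite hG p q),
      finsum_mem_eq_finite_toFinset_sum _ (G.minExt_finite hG p q), map_sum]
    simp only [map_mul, map_star]
  ck E hE x hx l hl hlE := by
    have := congrArg (Unitization.starMap φ) (ht.ck E hE x hx l hl hlE)
    rw [starMap_prod, map_zero] at this
    simpa only [map_sub, map_mul, map_star] using this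

theorem IsRelCKFamily.of_map {G : KGraph k Λ} {𝓔 : Set (Finset (Mor Λ))}
    (hG : G.FinitelyAligned) (h𝓔 : 𝓔 ⊆ G.FE) {ι : Type*}
    {A : Type*} {B : ι → Type*} [NonUnitalCStarAlgebra A] [∀ i, NonUnitalCStarAlgebra (B i)]
    (φ : ∀ i, A →⋆ₙₐ[ℂ] B i) (hφ : ∀ a a', (∀ i, φ i a = φ i a') → a = a')
    {t : Mor Λ → A} (ht : ∀ i, G.IsRelCKFamily 𝓔 (fun p => φ i (t p))) :
    G.IsRelCKFamily 𝓔 t where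
  partialIsometry p := hφ _ _ fun i => by
    rw [map_mul, map_mul, map_star]; exact (ht i).partialIsometry p
  tck1_proj x := by
    refine ⟨hφ _ _ fun i => ?_, hφ _ _ fun i => ?_⟩
    · rw [map_mul]; exact ((ht i).tck1_proj x).isIdempotentElem
    · rw [map_star]; exact ((ht i).tck1_proj x).isSelfAdjoint
  tck1_orth x y h := hφ _ _ fun i => by
    rw [map_mul, map_zero]; exact (ht i).tck1_orth x y h
  tck2_comp p q h := hφ _ _ fun i => by rw [map_mul]; exact (ht i).tck2_comp p q h
  tck2_zero p q h := hφ _ _ fun i => by rw [map_mul, map_zero]; exact (ht i).tck2_zero p q h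
  tck3 p q := hφ _ _ fun i => by
    have := (ht i).tck3 p q
    rw [finsum_mem_eq_finite_toFinset_sum _ (G.minExt_finite hG p q)] at this ⊢
    simpa only [map_mul, map_star, map_sum] using this
  ck E hE x hx l hl hlE := by
    obtain ⟨q, hq⟩ := G.FE_nonempty (h𝓔 hE)
    obtain ⟨a, ha⟩ := prod_inr_mem (fun p => t (Mor.idMor x) - t p * star (t p)) l
      (List.ne_nil_of_mem ((hlE q).2 hq))
    rw [ha]
    suffices a = 0 by rw [this, Unitization.inr_zero]
    refine hφ _ _ fun i => ?_
    have h1 := (ht i).ck E hE x hx l hl hlE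
    have h2 := congrArg (Unitization.starMap (φ i)) ha
    rw [starMap_prod, Unitization.starMap_inr] at h2
    simp only [map_sub, map_mul, map_star] at h2
    rw [h1] at h2
    rw [map_zero]
    exact (Unitization.inr_injective (h2.symm.trans (Unitization.inr_zero ℂ).symm))

/-- A relative Cuntz-Krieger `(Λ; 𝓔)`-family together with the C⋆-algebra (in `Type`) in which it
lives. A C⋆-algebra generated by a countable family has at most continuum many elements, so `Type`
is large enough: see `RelCKAlgebra.exists_unique_lift`, which has no restriction on universes. -/
structure RelCKRep (G : KGraph k Λ) (𝓔 : Set (Finset (Mor Λ))) : Type (max u v 1) where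
  carrier : Type
  [inst : NonUnitalCStarAlgebra carrier]
  t : Mor Λ → carrier
  isFamily : G.IsRelCKFamily 𝓔 t

attribute [instance] RelCKRep.inst

/-- The family whose coordinate in each relative Cuntz-Krieger family is that family, as an element
of the `ℓ^∞`-direct product of C⋆-algebras. -/
noncomputable def productFamily (G : KGraph k Λ) (𝓔 : Set (Finset (Mor Λ))) (p : Mor Λ) :
    lp (fun R : G.RelCKRep 𝓔 => R.carrier) ∞ :=
  ⟨fun R => R.t p, memℓp_infty ⟨1, by rintro _ ⟨R, rfl⟩; exact R.isFamily.norm_le p⟩⟩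

/-- The C⋆-subalgebra of the product of all relative Cuntz-Krieger families generated by the
product family. -/
noncomputable def relCKSubalgebra (G : KGraph k Λ) (𝓔 : Set (Finset (Mor Λ))) :
    NonUnitalStarSubalgebra ℂ (lp (fun R : G.RelCKRep 𝓔 => R.carrier) ∞) :=
  (NonUnitalStarAlgebra.adjoin ℂ (Set.range (G.productFamily 𝓔))).topologicalClosure

/-- The relative Cuntz-Krieger algebra `C⋆(Λ; 𝓔)`, the universal C⋆-algebra generated by a relative
Cuntz-Krieger `(Λ; 𝓔)`-family. -/
abbrev RelCKAlgebra (G : KGraph k Λ) (𝓔 : Set (Finset (Mor Λ))) : Type (max u v 1) :=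
  G.relCKSubalgebra 𝓔

noncomputable instance (G : KGraph k Λ) (𝓔 : Set (Finset (Mor Λ))) :
    NonUnitalCStarAlgebra (G.RelCKAlgebra 𝓔) :=
  NonUnitalStarSubalgebra.nonUnitalCStarAlgebra (G.relCKSubalgebra 𝓔)
    (h_closed := NonUnitalStarSubalgebra.isClosed_topologicalClosure _)

/-- The universal family `s_𝓔(p)`. -/
noncomputable def RelCKAlgebra.gen (G : KGraph k Λ) (𝓔 : Set (Finset (Mor Λ))) (p : Mor Λ) :
    G.RelCKAlgebra 𝓔 :=
  ⟨G.productFamily 𝓔 p, NonUnitalStarSubalgebra.le_topologicalClosure _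
    (NonUnitalStarAlgebra.subset_adjoin ℂ _ ⟨p, rfl⟩)⟩

/-- The coordinate projections of the `ℓ^∞`-direct product, as ⋆-homomorphisms. -/
noncomputable def coordHom {G : KGraph k Λ} {𝓔 : Set (Finset (Mor Λ))} (R : G.RelCKRep 𝓔) :
    lp (fun R : G.RelCKRep 𝓔 => R.carrier) ∞ →⋆ₙₐ[ℂ] R.carrier where
  toFun f := f R
  map_smul' _ _ := rfl
  map_zero' := rfl
  map_add' _ _ := rfl
  map_mul' _ _ := rfl
  map_star' _ := rfl

theorem RelCKAlgebra.isRelCKFamily_gen (G : KGraph k Λ) (hG : G.FinitelyAligned)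
    (𝓔 : Set (Finset (Mor Λ))) (h𝓔 : 𝓔 ⊆ G.FE) :
    G.IsRelCKFamily 𝓔 (RelCKAlgebra.gen G 𝓔) := by
  refine .of_map hG h𝓔 (ι := G.RelCKRep 𝓔) (B := fun R => R.carrier)
    (fun R => (coordHom R).comp (NonUnitalStarSubalgebraClass.subtype (G.relCKSubalgebra 𝓔)))
    (fun a a' h => ?_) (fun R => R.isFamily)
  exact Subtype.ext (lp.ext (funext h))

/-- A C⋆-algebra structure can be transported to a type in another universe. -/
theorem exists_transport {B : Type w} [NonUnitalCStarAlgebra B] {C : Type} (e : C ≃ B) :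
    ∃ _ : NonUnitalCStarAlgebra C, Nonempty (C ≃⋆ₐ[ℂ] B) := by
  let _ : NonUnitalNormedRing C :=
    let _ := e.nonUnitalRing
    NonUnitalNormedRing.induced C B (e.ringEquiv : _ ≃+* B) e.injective
  let _ : Module ℂ C := e.module ℂ
  let _ : Star C := ⟨fun x => e.symm (star (e x))⟩
  have hn : ∀ x : C, ‖x‖ = ‖e x‖ := fun x => rfl
  have ha : ∀ x y : C, e (x + y) = e x + e y := fun x y => e.apply_symm_apply _
  have hm : ∀ x y : C, e (x * y) = e x * e y := fun x y => e.apply_symm_apply _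
  have hs : ∀ x : C, e (star x) = star (e x) := fun x => e.apply_symm_apply _
  have hc : ∀ (c : ℂ) (x : C), e (c • x) = c • e x := fun c x => e.apply_symm_apply _
  let _ : StarRing C :=
    { star_involutive := fun x => e.injective (by rw [hs, hs, star_star])
      star_mul := fun x y => e.injective (by rw [hs, hm, hm, hs, hs, star_mul])
      star_add := fun x y => e.injective (by rw [hs, ha, ha, hs, hs, star_add]) }
  let _ : NormedSpace ℂ C :=
    ⟨fun c x => show ‖e (c • x)‖ ≤ ‖c‖ * ‖e x‖ by rw [hc, norm_smul]⟩
  have hiso : Isometry e := AddMonoidHomClass.isometry_of_norm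
    (⟨⟨e, by exact e.apply_symm_apply 0⟩, ha⟩ : C →+ B) fun _ => rfl
  have : CompleteSpace C :=
    (completeSpace_iff_isComplete_range hiso.isUniformInducing).2 <| by
      rw [e.surjective.range_eq]; exact isComplete_univ
  have : CStarRing C :=
    ⟨fun x => by rw [hn, hn, hm, hs, CStarRing.norm_star_mul_self]⟩
  have : IsScalarTower ℂ C C :=
    ⟨fun c x y => e.injective (by
      rw [smul_eq_mul, smul_eq_mul, hc, hm, hm, hc, smul_mul_assoc])⟩
  have : SMulCommClass ℂ C C :=
    ⟨fun c x y => e.injective (by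
      rw [smul_eq_mul, smul_eq_mul, hc, hm, hm, hc, mul_smul_comm])⟩
  have : StarModule ℂ C :=
    ⟨fun c x => e.injective (by rw [hs, hc, hc, hs, star_smul])⟩
  exact ⟨NonUnitalCStarAlgebra.mk, ⟨{ e with map_mul' := hm, map_add' := ha, map_star' := hs, map_smul' := hc }⟩⟩

/-- The C⋆-subalgebra generated by a countable set has at most continuum many elements. -/
theorem small_adjoin {B : Type w} [NonUnitalCStarAlgebra B] (S : Set B) (hS : S.Countable) :
    Small.{0} (NonUnitalStarAlgebra.adjoin ℂ S).topologicalClosure := by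
  have hsep : TopologicalSpace.IsSeparable
      ((NonUnitalStarAlgebra.adjoin ℂ S).topologicalClosure : Set B) := by
    have hT : (S ∪ star S).Countable := hS.union (hS.preimage star_injective)
    have h1 : ((NonUnitalStarAlgebra.adjoin ℂ S : NonUnitalStarSubalgebra ℂ B) : Set B) =
        (Submodule.span ℂ (Subsemigroup.closure (S ∪ star S) : Set B) : Set B) := by
      rw [← NonUnitalAlgebra.adjoin_eq_span]; rfl
    have h2 : (Subsemigroup.closure (S ∪ star S) : Set B).Countable := by
      have := hT.to_subtype
      let f : FreeSemigroup (S ∪ star S : Set B) →ₙ* B := FreeSemigroup.lift fun x => (x : B)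
      have hc : Countable (FreeSemigroup (S ∪ star S : Set B)) :=
        Function.Injective.countable (f := fun x => (x.head, x.tail)) fun x y h =>
          FreeSemigroup.ext (congrArg Prod.fst h) (congrArg Prod.snd h)
      refine (Set.countable_range f).mono ?_
      rw [← MulHom.coe_srange]
      exact Subsemigroup.closure_le.2 fun x hx =>
        ⟨FreeSemigroup.of ⟨x, hx⟩, FreeSemigroup.lift_of _ _⟩
    show TopologicalSpace.IsSeparable (closure _)
    refine TopologicalSpace.IsSeparable.closure ?_
    rw [h1]
    exact h2.isSeparable.span
  have := hsep.separableSpace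
  set X := (NonUnitalStarAlgebra.adjoin ℂ S).topologicalClosure
  refine small_of_injective (β := ℕ → ℝ)
    (f := fun x n => dist x (TopologicalSpace.denseSeq X n)) fun x y h => ?_
  refine dist_le_zero.1 (le_of_forall_pos_le_add fun ε hε => ?_)
  obtain ⟨n, hn⟩ := (TopologicalSpace.denseRange_denseSeq X).exists_dist_lt x (half_pos hε)
  have := congrFun h n
  have := dist_triangle_right x y (TopologicalSpace.denseSeq X n)
  simp only at *
  linarith

theorem RelCKAlgebra.exists_unique_lift (G : KGraph k Λ) (hG : G.FinitelyAligned)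
    (𝓔 : Set (Finset (Mor Λ))) (h𝓔 : 𝓔 ⊆ G.FE) {B : Type w} [NonUnitalCStarAlgebra B]
    (t : Mor Λ → B) (ht : G.IsRelCKFamily 𝓔 t) :
    ∃! φ : G.RelCKAlgebra 𝓔 →⋆ₙₐ[ℂ] B, ∀ p, φ (RelCKAlgebra.gen G 𝓔 p) = t p := by
  have := G.countable
  let S := (NonUnitalStarAlgebra.adjoin ℂ (Set.range t)).topologicalClosure
  let _ : NonUnitalCStarAlgebra S := NonUnitalStarSubalgebra.nonUnitalCStarAlgebra S
    (h_closed := NonUnitalStarSubalgebra.isClosed_topologicalClosure _)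
  let ι : S →⋆ₙₐ[ℂ] B := NonUnitalStarSubalgebraClass.subtype S
  let t' : Mor Λ → S := fun p => ⟨t p, NonUnitalStarSubalgebra.le_topologicalClosure _
    (NonUnitalStarAlgebra.subset_adjoin ℂ _ ⟨p, rfl⟩)⟩
  have ht' : G.IsRelCKFamily 𝓔 t' := .of_map hG h𝓔 (ι := Unit) (fun _ => ι)
    (fun a a' h => Subtype.ext (h ())) fun _ => ht
  have : Small.{0} S := small_adjoin _ (Set.countable_range t)
  obtain ⟨C, ⟨e₀⟩⟩ : ∃ C : Type, Nonempty (C ≃ S) := ⟨_, ⟨(equivShrink.{0} S).symm⟩⟩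
  obtain ⟨_, ⟨e⟩⟩ := exists_transport e₀
  let R : G.RelCKRep 𝓔 := ⟨C, fun p => e.symm (t' p), ht'.map hG (e.symm : S →⋆ₙₐ[ℂ] C)⟩
  let φ : G.RelCKAlgebra 𝓔 →⋆ₙₐ[ℂ] B := (ι.comp (e : C →⋆ₙₐ[ℂ] S)).comp
    ((coordHom R).comp (NonUnitalStarSubalgebraClass.subtype (G.relCKSubalgebra 𝓔)))
  have hφ : ∀ p, φ (RelCKAlgebra.gen G 𝓔 p) = t p := fun p =>
    congrArg ι (e.apply_symm_apply (t' p))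
  refine ⟨φ, hφ, fun ψ hψ => ?_⟩
  have hcl : IsClosed {x : G.RelCKAlgebra 𝓔 | ψ x = φ x} :=
    isClosed_eq
      (AddMonoidHomClass.continuous_of_bound ψ 1 fun x => by
        rw [one_mul]; exact NonUnitalStarAlgHom.norm_apply_le ψ x)
      (AddMonoidHomClass.continuous_of_bound φ 1 fun x => by
        rw [one_mul]; exact NonUnitalStarAlgHom.norm_apply_le φ x)
  have hcl' : IsClosed ((↑) '' {x : G.RelCKAlgebra 𝓔 | ψ x = φ x} :
      Set (lp (fun R : G.RelCKRep 𝓔 => R.carrier) ∞)) :=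
    (NonUnitalStarSubalgebra.isClosed_topologicalClosure _).isClosedEmbedding_subtypeVal.isClosedMap
      _ hcl
  have hsub : ((NonUnitalStarAlgebra.adjoin ℂ (Set.range (G.productFamily 𝓔)) :
      NonUnitalStarSubalgebra ℂ _) : Set (lp (fun R : G.RelCKRep 𝓔 => R.carrier) ∞)) ⊆
      (↑) '' {x : G.RelCKAlgebra 𝓔 | ψ x = φ x} := by
    intro y hy
    induction hy using NonUnitalStarAlgebra.adjoin_induction with
    | mem x hx =>
      obtain ⟨p, rfl⟩ := hx
      exact ⟨RelCKAlgebra.gen G 𝓔 p, (hψ p).trans (hφ p).symm, rfl⟩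
    | add x y _ _ hx hy =>
      obtain ⟨x, hx, rfl⟩ := hx
      obtain ⟨y, hy, rfl⟩ := hy
      exact ⟨x + y, by rw [Set.mem_ofPred_eq] at *; rw [map_add, map_add, hx, hy], rfl⟩
    | zero => exact ⟨0, by rw [Set.mem_ofPred_eq, map_zero, map_zero], rfl⟩
    | mul x y _ _ hx hy =>
      obtain ⟨x, hx, rfl⟩ := hx
      obtain ⟨y, hy, rfl⟩ := hy
      exact ⟨x * y, by rw [Set.mem_ofPred_eq] at *; rw [map_mul, map_mul, hx, hy], rfl⟩
    | smul c x _ hx =>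
      obtain ⟨x, hx, rfl⟩ := hx
      exact ⟨c • x, by rw [Set.mem_ofPred_eq] at *; rw [map_smul, map_smul, hx], rfl⟩
    | star x _ hx =>
      obtain ⟨x, hx, rfl⟩ := hx
      exact ⟨star x, by rw [Set.mem_ofPred_eq] at *; rw [map_star, map_star, hx], rfl⟩
  ext ⟨x, hx⟩
  obtain ⟨x', hx', h⟩ := closure_minimal hsub hcl' hx
  obtain rfl : x' = ⟨x, hx⟩ := Subtype.ext h
  exact hx'

end KGraph

/-- A C⋆-algebra is AF (approximately finite-dimensional) if it is the closure of the union of an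
increasing sequence of finite-dimensional C⋆-subalgebras. (Finite-dimensional ⋆-subalgebras are
automatically closed.) -/
def IsAF (A : Type w) [NonUnitalCStarAlgebra A] : Prop :=
  ∃ F : ℕ → NonUnitalStarSubalgebra ℂ A, Monotone F ∧
    (∀ n, FiniteDimensional ℂ (F n)) ∧ Dense (⋃ n, (F n : Set A))

/-!
The algebra is the closed span of the elements `t_p t_q^*`, and
`t_p t_q^* t_r t_l^* = ∑ t_{pa} t_{lc}^*`, the sum running over `(a, c) ∈ Λ^min(q, r)`. So a finite
set `H` of paths spans a finite-dimensional ⋆-subalgebra as soon as `p a ∈ H` whenever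
`p, q, r ∈ H`, `s(p) = s(q)` and `(a, c) ∈ Λ^min(q, r)`, and it remains to see that every finite set
`F` of paths lies in a finite set with this closure property (`ExtClosure.finite`).

Call `b(s(p))` the level of `p`. If `(a, c) ∈ Λ^min(q, r)` then the level of `a` is the join of the
levels of `q` and `r` (`level_minExt`), so the levels in the closure of `F` lie in the finite
join-semilattice generated by the levels of `F`, and one may induct on the level `n`. Let `H` be
the part of the closure of level `< n`, already known to be finite. The paths of level `n` that are
in `F`, or arise in one step from three paths in `H`, form a finite set `newPaths`. Every further
path of level `n` is obtained by replacing an initial segment `q ∈ H` of a path of level `n` by some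
`p ∈ H` with `s(p) = s(q)`. Two such replacements in a row either amount to a single one, made at a
minimal common extension of the two segments involved, or lead back to `newPaths`
(`replaced_replaced`). Hence one replacement suffices, and level `n` is finite.
-/

namespace Mor

variable {Λ : Type u} [Category.{v} Λ]

theorem comp_assoc (p q l : Mor Λ) (h : q.r = p.s) (h' : l.r = q.s) :
    (p.comp q h).comp l h' = p.comp (q.comp l h') h := by
  simp [comp]

theorem comp_idMor (p : Mor Λ) (x : Λ) (h : x = p.s) : p.comp (idMor x) h = p := by
  subst h
  simp [comp, idMor]

theorem idMor_comp (p : Mor Λ) (x : Λ) (h : p.r = x) : (idMor x).comp p h = p := by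
  subst h
  simp [comp, idMor]

end Mor

namespace KGraph

variable {k : ℕ} {Λ : Type u} [Category.{v} Λ]

/-! ### Factorisations -/

theorem eq_idMor_of_d_eq_zero (G : KGraph k Λ) {a : Mor Λ} (ha : G.d a = 0) :
    a = Mor.idMor a.s := by
  have := (G.factorisation a 0 0 (by simpa using ha)).unique
    (y₁ := (a, Mor.idMor a.s)) (y₂ := (Mor.idMor a.r, a))
    ⟨ha, G.d_id _, rfl, (Mor.comp_idMor a _ _).symm⟩
    ⟨G.d_id _, ha, rfl, (Mor.idMor_comp a _ _).symm⟩
  exact (congrArg Prod.snd this).symm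

theorem comp_eq_left (G : KGraph k Λ) (p : Mor Λ) {a : Mor Λ} (h : a.r = p.s)
    (ha : G.d a = 0) : p.comp a h = p := by
  obtain ⟨x, rfl⟩ : ∃ x, a = Mor.idMor x := ⟨_, G.eq_idMor_of_d_eq_zero ha⟩
  exact Mor.comp_idMor p x h

/-- Of two initial segments of a path, the one of smaller degree is an initial segment of the
other. -/
theorem exists_comp_of_d_le (G : KGraph k Λ) {p a l w : Mor Λ} {h : a.r = p.s} {h' : w.r = l.s}
    (e : p.comp a h = l.comp w h') (hd : G.d p ≤ G.d l) :
    ∃ (g : Mor Λ) (hg : g.r = p.s) (hw : w.r = g.s), l = p.comp g hg ∧ a = g.comp w hw := by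
  obtain ⟨⟨p', g⟩, ⟨h1, h2, h3, rfl⟩, -⟩ :=
    G.factorisation l (G.d p) (G.d l - G.d p) (add_tsub_cancel_of_le hd).symm
  dsimp only at h1 h2 h3 e hd ⊢
  change w.r = g.s at h'
  have h4 : (g.comp w h').r = p'.s := h3
  replace e : p.comp a h = p'.comp (g.comp w h') h4 := e.trans (Mor.comp_assoc p' g w h3 h')
  have hda : G.d (g.comp w h') = G.d a := by
    have := congrArg G.d e
    rw [G.d_comp, G.d_comp, h1] at this
    exact (add_left_cancel this).symm
  have := (G.factorisation _ _ _ (G.d_comp p a h)).unique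
    (y₁ := (p, a)) (y₂ := (p', g.comp w h')) ⟨rfl, rfl, h, rfl⟩ ⟨h1, hda, h4, e⟩
  obtain ⟨rfl, rfl⟩ := Prod.mk.inj this
  exact ⟨g, h3, h', rfl, rfl⟩

theorem minExt_swap (G : KGraph k Λ) {p q a c : Mor Λ} (h : (a, c) ∈ G.minExt p q) :
    (c, a) ∈ G.minExt q p := by
  obtain ⟨h, h', e, hd, h1, h2⟩ := h
  exact ⟨h', h, e.symm, e ▸ ⟨hd.trans (sup_comm _ _), h2, h1⟩⟩

/-! ### Levels -/

theorem level_le (G : KGraph k Λ) {b : Λ → (Fin k → ℤ)}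
    (hb : ∀ (p : Mor Λ) (i : Fin k), (G.d p i : ℤ) = b p.s i - b p.r i) (p : Mor Λ) :
    b p.r ≤ b p.s := fun i => by
  have := hb p i
  show b p.r i ≤ b p.s i
  omega

theorem d_eq_zero_of_level (G : KGraph k Λ) {b : Λ → (Fin k → ℤ)}
    (hb : ∀ (p : Mor Λ) (i : Fin k), (G.d p i : ℤ) = b p.s i - b p.r i) {p : Mor Λ}
    (h : b p.s = b p.r) : G.d p = 0 := by
  funext i
  have := hb p i
  rw [h, sub_self] at this
  exact_mod_cast this

/-- For paths with the same range, joins of degrees become joins of levels. -/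
theorem level_eq_sup (G : KGraph k Λ) {b : Λ → (Fin k → ℤ)}
    (hb : ∀ (p : Mor Λ) (i : Fin k), (G.d p i : ℤ) = b p.s i - b p.r i) {p q l : Mor Λ}
    (hp : p.r = l.r) (hq : q.r = l.r) (hd : G.d l = G.d p ⊔ G.d q) :
    b l.s = b p.s ⊔ b q.s := by
  funext i
  have h1 := hb p i
  have h2 := hb q i
  have h3 := hb l i
  have h4 := congrFun hd i
  rw [hp] at h1
  rw [hq] at h2
  simp only [Pi.sup_apply] at h4 ⊢
  omega

theorem level_minExt (G : KGraph k Λ) {b : Λ → (Fin k → ℤ)}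
    (hb : ∀ (p : Mor Λ) (i : Fin k), (G.d p i : ℤ) = b p.s i - b p.r i) {p q a c : Mor Λ}
    (h : (a, c) ∈ G.minExt p q) : b a.s = b p.s ⊔ b q.s := by
  obtain ⟨h1, h2, e, hd, -⟩ := h
  have hr : q.r = p.r := (congrArg Mor.r e).symm
  exact G.level_eq_sup hb (l := p.comp a h1) rfl hr hd

/-! ### Closing a finite set of paths under minimal extensions -/

/-- The least set of paths that contains `F` and contains `p a` whenever it contains `p`, `q`, `l`
with `s(p) = s(q)` and `(a, c) ∈ Λ^min(q, l)`. -/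
inductive ExtClosure (G : KGraph k Λ) (F : Set (Mor Λ)) : Mor Λ → Prop
  | base {p : Mor Λ} (hp : p ∈ F) : ExtClosure G F p
  | step {p q l a c : Mor Λ} (hp : ExtClosure G F p) (hq : ExtClosure G F q)
      (hl : ExtClosure G F l) (hs : p.s = q.s) (hac : (a, c) ∈ G.minExt q l) (h : a.r = p.s) :
      ExtClosure G F (p.comp a h)

theorem ExtClosure.mono {G : KGraph k Λ} {F F' : Set (Mor Λ)} (hF : F ⊆ F') {p : Mor Λ}
    (hp : G.ExtClosure F p) : G.ExtClosure F' p := by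
  induction hp with
  | base hp => exact .base (hF hp)
  | step _ _ _ hs hac h hp hq hl => exact .step hp hq hl hs hac h

theorem ExtClosure.level_mem {G : KGraph k Λ} {b : Λ → (Fin k → ℤ)}
    (hb : ∀ (p : Mor Λ) (i : Fin k), (G.d p i : ℤ) = b p.s i - b p.r i) {F : Set (Mor Λ)}
    {p : Mor Λ} (hp : G.ExtClosure F p) :
    b p.s ∈ supClosure ((fun p : Mor Λ => b p.s) '' F) := by
  induction hp with
  | base hp => exact subset_supClosure ⟨_, hp, rfl⟩
  | step _ _ _ hs hac h hp hq hl =>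
    exact (G.level_minExt hb hac).symm ▸ supClosed_supClosure hq hl

/-- The paths of `F`, and those that arise from three paths of `H` by one closure step. -/
def newPaths (G : KGraph k Λ) (F H : Set (Mor Λ)) : Set (Mor Λ) :=
  F ∪ {x | ∃ p ∈ H, ∃ q ∈ H, ∃ l ∈ H, p.s = q.s ∧ ∃ a c, (a, c) ∈ G.minExt q l ∧
    ∃ h : a.r = p.s, x = p.comp a h}

/-- The paths obtained from those of `B` by replacing an initial segment in `H` by another path of
`H` with the same source. -/
def replaced (H B : Set (Mor Λ)) : Set (Mor Λ) :=
  {x | ∃ p ∈ H, ∃ q ∈ H, p.s = q.s ∧ ∃ (a : Mor Λ) (h : a.r = p.s) (h' : a.r = q.s),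
    q.comp a h' ∈ B ∧ x = p.comp a h}

theorem newPaths_finite (G : KGraph k Λ) (hG : G.FinitelyAligned) {F H : Set (Mor Λ)}
    (hF : F.Finite) (hH : H.Finite) : (G.newPaths F H).Finite := by
  classical
  refine hF.union <| (hH.biUnion fun p _ => hH.biUnion fun q _ => hH.biUnion fun l _ =>
    (G.minExt_finite hG q l).image fun ac => if h : ac.1.r = p.s then p.comp ac.1 h else p).subset ?_
  rintro _ ⟨p, hp, q, hq, l, hl, -, a, c, hac, h, rfl⟩
  simp only [Set.mem_iUnion]
  exact ⟨p, hp, q, hq, l, hl, (a, c), hac, dif_pos h⟩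

theorem replaced_finite (G : KGraph k Λ) {H B : Set (Mor Λ)} (hH : H.Finite) (hB : B.Finite) :
    (replaced H B).Finite := by
  refine (hH.biUnion fun p _ => hH.biUnion fun q _ => hB.biUnion (t := fun y =>
    {x | ∃ (a : Mor Λ) (h : a.r = p.s) (h' : a.r = q.s), q.comp a h' = y ∧ x = p.comp a h})
    fun y _ => Set.Subsingleton.finite ?_).subset ?_
  · rintro _ ⟨a, h, h', e, rfl⟩ _ ⟨a', g, g', e', rfl⟩
    obtain rfl := G.comp_left_cancel (e.trans e'.symm)
    rfl
  · rintro x ⟨p, hp, q, hq, -, a, h, h', hB, rfl⟩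
    simp only [Set.mem_iUnion]
    exact ⟨p, hp, q, hq, _, hB, a, h, h', rfl, rfl⟩

/-- Two successive replacements amount to one, or produce a path that a closure step produces from
`H`. Here `H` is the part of a closure below the level `n`. -/
theorem replaced_replaced (G : KGraph k Λ) {b : Λ → (Fin k → ℤ)}
    (hb : ∀ (p : Mor Λ) (i : Fin k), (G.d p i : ℤ) = b p.s i - b p.r i)
    {F B : Set (Mor Λ)} {n : Fin k → ℤ} {H : Set (Mor Λ)}
    (hH : H = {p | G.ExtClosure F p ∧ b p.s < n}) (hB : ∀ p ∈ B, b p.s = n)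
    {x : Mor Λ} (hx : x ∈ replaced H (replaced H B)) :
    x ∈ G.newPaths F H ∪ replaced H B := by
  obtain ⟨p, hp, q, hq, hpq, a, ha, ha', ⟨p', hp', q', hq', hpq', a', h, h', hy, e⟩, rfl⟩ := hx
  have hn : b a'.s = n := hB (q'.comp a' h') hy
  -- `l` is the initial segment of `q a = p' a'` that is a minimal common extension of `q` and `p'`
  obtain ⟨⟨l, w⟩, ⟨hl, -, hw, e'⟩, -⟩ := G.factorisation (q.comp a ha') (G.d q ⊔ G.d p')
    (G.d (q.comp a ha') - G.d q ⊔ G.d p') (add_tsub_cancel_of_le (sup_le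
      (by rw [G.d_comp]; exact le_self_add) (by rw [e, G.d_comp]; exact le_self_add))).symm
  dsimp only at hl hw e'
  obtain ⟨g, hg, hgw, rfl, rfl⟩ := G.exists_comp_of_d_le e' (hl ▸ le_sup_left)
  obtain ⟨g', hg', hgw', e'', rfl⟩ := G.exists_comp_of_d_le (e.symm.trans e') (hl ▸ le_sup_right)
  have hmin : (g, g') ∈ G.minExt q p' := ⟨hg, hg', e'', hl, ⟨g, hg, rfl⟩, ⟨g', hg', e''⟩⟩
  have hmin' : (g', g) ∈ G.minExt p' q := G.minExt_swap hmin
  have hgs : g.s = g'.s := hgw.symm.trans hgw'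
  have hle : b g.s ≤ n := by
    rw [← hn, ← hgw]
    exact G.level_le hb w
  have hgp : g.r = p.s := hg.trans hpq.symm
  rcases hle.eq_or_lt with heq | hlt
  -- if `l` has level `n`, then `l = q a`, and a single closure step from `H` gives `p a`
  · have hw0 : G.d w = 0 := G.d_eq_zero_of_level hb (by rw [hgw, heq]; exact hn)
    refine Or.inl (Or.inr ⟨p, hp, q, hq, p', hp', hpq, g, g', hmin, hgp, ?_⟩)
    exact (Mor.comp_assoc p g w hgp hgw).symm.trans (G.comp_eq_left _ _ hw0)
  -- otherwise `p g` and `q' g'` lie in `H`, and the former replaces the latter in `q' a' ∈ B`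
  · have hgq' : g'.r = q'.s := hg'.trans hpq'
    refine Or.inr ⟨p.comp g hgp, ?_, q'.comp g' hgq', ?_, hgs, w, hgw, hgw', ?_, ?_⟩
    · rw [hH] at hp hq hp' ⊢
      exact ⟨.step hp.1 hq.1 hp'.1 hpq hmin hgp, hlt⟩
    · rw [hH] at hp' hq' hq ⊢
      exact ⟨.step hq'.1 hp'.1 hq.1 hpq'.symm hmin' hgq', hgs ▸ hlt⟩
    · exact (Mor.comp_assoc q' g' w hgq' hgw').symm ▸ hy
    · exact (Mor.comp_assoc p g w hgp hgw).symm

/-- One level of the closure is reached from `newPaths` by at most one replacement. -/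
theorem ExtClosure.mem_newPaths_union_replaced {G : KGraph k Λ} {b : Λ → (Fin k → ℤ)}
    (hb : ∀ (p : Mor Λ) (i : Fin k), (G.d p i : ℤ) = b p.s i - b p.r i)
    {F : Set (Mor Λ)} {n : Fin k → ℤ} {H : Set (Mor Λ)}
    (hH : H = {p | G.ExtClosure F p ∧ b p.s < n}) {p : Mor Λ} (hp : G.ExtClosure F p)
    (hpn : b p.s = n) :
    p ∈ G.newPaths F H ∪ replaced H {x ∈ G.newPaths F H | b x.s = n} := by
  induction hp with
  | base hp => exact Or.inl (Or.inl hp)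
  | @step p q l a c hp hq hl hs hac h ihp ihq ihl =>
    have hn : b q.s ⊔ b l.s = n := (G.level_minExt hb hac).symm.trans hpn
    have hqn : b q.s ≤ n := hn ▸ le_sup_left
    have hln : b l.s ≤ n := hn ▸ le_sup_right
    rcases hqn.eq_or_lt with hqn | hqn
    -- a path `q` already of level `n` has only trivial extensions of level `n`
    · have ha : G.d a = 0 := G.d_eq_zero_of_level hb (by rw [h, hs, hqn]; exact hpn)
      rw [G.comp_eq_left p h ha]
      exact ihp (hs ▸ hqn)
    have hpH : p ∈ H := hH ▸ ⟨hp, hs ▸ hqn⟩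
    have hqH : q ∈ H := hH ▸ ⟨hq, hqn⟩
    rcases hln.eq_or_lt with hln | hln
    · -- here `l = q a`, and `p a` arises from `l` by replacing `q` with `p`
      obtain ⟨h1, h2, e, -⟩ := id hac
      have hc : G.d c = 0 := G.d_eq_zero_of_level hb (by
        rw [h2, hln, ← hpn]; exact (congrArg (fun x => b (Mor.s x)) e).symm)
      rw [G.comp_eq_left l h2 hc] at e
      rcases ihl hln with hl' | hl'
      · exact Or.inr ⟨p, hpH, q, hqH, hs, a, h, h1, ⟨e ▸ hl', hpn⟩, rfl⟩
      · exact G.replaced_replaced hb hH (fun _ hx => hx.2)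
          ⟨p, hpH, q, hqH, hs, a, h, h1, e ▸ hl', rfl⟩
    · exact Or.inl (Or.inr ⟨p, hpH, q, hqH, l, hH ▸ ⟨hl, hln⟩, hs, a, c, hac, h, rfl⟩)

/-- The closure of a finite set of paths is finite. -/
theorem ExtClosure.finite {G : KGraph k Λ} (hG : G.FinitelyAligned) {b : Λ → (Fin k → ℤ)}
    (hb : ∀ (p : Mor Λ) (i : Fin k), (G.d p i : ℤ) = b p.s i - b p.r i) {F : Set (Mor Λ)}
    (hF : F.Finite) : {p | G.ExtClosure F p}.Finite := by
  set L := supClosure ((fun p : Mor Λ => b p.s) '' F)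
  have hL : L.Finite := (hF.image _).supClosure
  have key : ∀ n ∈ L, {p | G.ExtClosure F p ∧ b p.s = n}.Finite := by
    intro n hn
    refine (hL.wellFoundedOn (r := (· < ·))).induction
      (P := fun n => {p | G.ExtClosure F p ∧ b p.s = n}.Finite) hn fun n hn ih => ?_
    have hH : {p | G.ExtClosure F p ∧ b p.s < n}.Finite := by
      refine ((hL.subset (Set.sep_subset L (· < n))).biUnion
        fun m hm => ih m hm.1 hm.2).subset fun p hp => ?_
      exact Set.mem_biUnion (x := b p.s) ⟨hp.1.level_mem hb, hp.2⟩ ⟨hp.1, rfl⟩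
    have hB := G.newPaths_finite hG hF hH
    exact (hB.union (G.replaced_finite hH (hB.subset (Set.sep_subset _ _)))).subset
      fun p hp => hp.1.mem_newPaths_union_replaced hb rfl hp.2
  exact (hL.biUnion key).subset fun p hp =>
    Set.mem_biUnion (x := b p.s) (ExtClosure.level_mem hb hp) ⟨hp, rfl⟩

/-! ### The subalgebra spanned by a closed set of paths -/

theorem IsRelCKFamily.star_idMor {G : KGraph k Λ} {𝓔 : Set (Finset (Mor Λ))}
    {B : Type w} [NonUnitalCStarAlgebra B] {t : Mor Λ → B} (ht : G.IsRelCKFamily 𝓔 t) (x : Λ) :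
    star (t (Mor.idMor x)) = t (Mor.idMor x) :=
  (ht.tck1_proj x).isSelfAdjoint.star_eq

theorem IsRelCKFamily.mul_idMor {G : KGraph k Λ} {𝓔 : Set (Finset (Mor Λ))}
    {B : Type w} [NonUnitalCStarAlgebra B] {t : Mor Λ → B} (ht : G.IsRelCKFamily 𝓔 t)
    (p : Mor Λ) : t p * t (Mor.idMor p.s) = t p :=
  (ht.tck2_comp p (Mor.idMor p.s) rfl).trans (congrArg t (Mor.comp_idMor p _ rfl))

theorem IsRelCKFamily.mul_star_eq_zero {G : KGraph k Λ} {𝓔 : Set (Finset (Mor Λ))}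
    {B : Type w} [NonUnitalCStarAlgebra B] {t : Mor Λ → B} (ht : G.IsRelCKFamily 𝓔 t)
    {p q : Mor Λ} (h : p.s ≠ q.s) : t p * star (t q) = 0 := by
  rw [← ht.mul_idMor q, star_mul, ht.star_idMor, ← mul_assoc, ht.tck2_zero p (Mor.idMor q.s) h.symm, zero_mul]

/-- The span of the elements `t_p t_q^*` with `p`, `q` in the closure of `F`. -/
def closureSpan (G : KGraph k Λ) {B : Type w} [NonUnitalCStarAlgebra B] (t : Mor Λ → B)
    (F : Set (Mor Λ)) : Submodule ℂ B :=
  Submodule.span ℂ {x | ∃ p q, G.ExtClosure F p ∧ G.ExtClosure F q ∧ x = t p * star (t q)}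

theorem IsRelCKFamily.mul_mem_closureSpan {G : KGraph k Λ} (hG : G.FinitelyAligned)
    {𝓔 : Set (Finset (Mor Λ))} {B : Type w} [NonUnitalCStarAlgebra B] {t : Mor Λ → B}
    (ht : G.IsRelCKFamily 𝓔 t) {F : Set (Mor Λ)} {p q l m : Mor Λ} (hp : G.ExtClosure F p)
    (hq : G.ExtClosure F q) (hl : G.ExtClosure F l) (hm : G.ExtClosure F m) :
    t p * star (t q) * (t l * star (t m)) ∈ G.closureSpan t F := by
  by_cases hpq : p.s = q.s
  swap
  · rw [ht.mul_star_eq_zero hpq, zero_mul]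
    exact zero_mem _
  by_cases hlm : l.s = m.s
  swap
  · rw [ht.mul_star_eq_zero hlm, mul_zero]
    exact zero_mem _
  rw [show t p * star (t q) * (t l * star (t m)) = t p * (star (t q) * t l) * star (t m) by
      simp only [mul_assoc], ht.tck3 q l,
    finsum_mem_eq_finite_toFinset_sum _ (G.minExt_finite hG q l), Finset.mul_sum, Finset.sum_mul]
  refine sum_mem fun ac hac => ?_
  obtain ⟨a, c⟩ := ac
  replace hac : (a, c) ∈ G.minExt q l := (G.minExt_finite hG q l).mem_toFinset.1 hac
  have hca : (c, a) ∈ G.minExt l q := G.minExt_swap hac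
  have ha : a.r = p.s := hac.1.trans hpq.symm
  have hc : c.r = m.s := hca.1.trans hlm
  refine Submodule.subset_span ⟨p.comp a ha, m.comp c hc, .step hp hq hl hpq hac ha,
    .step hm hl hq hlm.symm hca hc, ?_⟩
  rw [← ht.tck2_comp, ← ht.tck2_comp, star_mul]
  simp only [mul_assoc]

/-- `closureSpan` as a ⋆-subalgebra. -/
def closureSubalgebra (G : KGraph k Λ) (hG : G.FinitelyAligned) {𝓔 : Set (Finset (Mor Λ))}
    {B : Type w} [NonUnitalCStarAlgebra B] {t : Mor Λ → B} (ht : G.IsRelCKFamily 𝓔 t)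
    (F : Set (Mor Λ)) : NonUnitalStarSubalgebra ℂ B where
  __ := G.closureSpan t F
  mul_mem' {x y} hx hy := by
    change x * y ∈ G.closureSpan t F
    refine Submodule.span_induction₂ (p := fun x y _ _ => x * y ∈ G.closureSpan t F)
      ?_ ?_ ?_ ?_ ?_ ?_ ?_ hx hy
    · rintro _ _ ⟨p, q, hp, hq, rfl⟩ ⟨l, m, hl, hm, rfl⟩
      exact ht.mul_mem_closureSpan hG hp hq hl hm
    · intro y _
      rw [zero_mul]
      exact zero_mem _
    · intro x _
      rw [mul_zero]
      exact zero_mem _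
    · intro x y z _ _ _ h h'
      rw [add_mul]
      exact add_mem h h'
    · intro x y z _ _ _ h h'
      rw [mul_add]
      exact add_mem h h'
    · intro c x y _ _ h
      rw [smul_mul_assoc]
      exact Submodule.smul_mem _ c h
    · intro c x y _ _ h
      rw [mul_smul_comm]
      exact Submodule.smul_mem _ c h
  star_mem' {x} hx := by
    change star x ∈ G.closureSpan t F
    refine Submodule.span_induction (p := fun x _ => star x ∈ G.closureSpan t F) ?_ ?_ ?_ ?_ hx
    · rintro _ ⟨p, q, hp, hq, rfl⟩
      rw [star_mul, star_star]
      exact Submodule.subset_span ⟨q, p, hq, hp, rfl⟩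
    · rw [star_zero]
      exact zero_mem _
    · intro x y _ _ h h'
      rw [star_add]
      exact add_mem h h'
    · intro c x _ h
      rw [star_smul]
      exact Submodule.smul_mem _ _ h

theorem closureSubalgebra_mono {G : KGraph k Λ} (hG : G.FinitelyAligned)
    {𝓔 : Set (Finset (Mor Λ))} {B : Type w} [NonUnitalCStarAlgebra B] {t : Mor Λ → B}
    (ht : G.IsRelCKFamily 𝓔 t) : Monotone (G.closureSubalgebra hG ht) := fun F F' h => by
  change G.closureSpan t F ≤ G.closureSpan t F'
  exact Submodule.span_mono fun x ⟨p, q, hp, hq, hx⟩ => ⟨p, q, hp.mono h, hq.mono h, hx⟩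

theorem closureSubalgebra_finiteDimensional {G : KGraph k Λ} (hG : G.FinitelyAligned)
    {𝓔 : Set (Finset (Mor Λ))} {B : Type w} [NonUnitalCStarAlgebra B] {t : Mor Λ → B}
    (ht : G.IsRelCKFamily 𝓔 t) {F : Set (Mor Λ)} (hF : {p | G.ExtClosure F p}.Finite) :
    FiniteDimensional ℂ (G.closureSubalgebra hG ht F) := by
  change FiniteDimensional ℂ (G.closureSpan t F)
  refine FiniteDimensional.span_of_finite ℂ ((hF.image2 (fun p q => t p * star (t q)) hF).subset ?_)
  rintro _ ⟨p, q, hp, hq, rfl⟩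
  exact ⟨p, hp, q, hq, rfl⟩

theorem mem_closureSubalgebra {G : KGraph k Λ} (hG : G.FinitelyAligned)
    {𝓔 : Set (Finset (Mor Λ))} {B : Type w} [NonUnitalCStarAlgebra B] {t : Mor Λ → B}
    (ht : G.IsRelCKFamily 𝓔 t) {F : Set (Mor Λ)} {p : Mor Λ} (hp : p ∈ F)
    (hs : Mor.idMor p.s ∈ F) : t p ∈ G.closureSubalgebra hG ht F := by
  refine Submodule.subset_span ⟨p, Mor.idMor p.s, .base hp, .base hs, ?_⟩
  rw [ht.star_idMor, ht.mul_idMor]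

/-! ### Density of the generated subalgebra -/

/-- The ⋆-subalgebra generated by the universal family is dense. -/
theorem RelCKAlgebra.dense_adjoin_gen (G : KGraph k Λ) (𝓔 : Set (Finset (Mor Λ))) :
    Dense (NonUnitalStarAlgebra.adjoin ℂ (Set.range (RelCKAlgebra.gen G 𝓔)) :
      Set (G.RelCKAlgebra 𝓔)) := by
  let ι := NonUnitalStarSubalgebraClass.subtype (G.relCKSubalgebra 𝓔)
  have h : (NonUnitalStarAlgebra.adjoin ℂ (Set.range (RelCKAlgebra.gen G 𝓔))).map ι =
      NonUnitalStarAlgebra.adjoin ℂ (Set.range (G.productFamily 𝓔)) := by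
    rw [NonUnitalStarAlgHom.map_adjoin, ← Set.range_comp]
    rfl
  rw [Subtype.dense_iff]
  intro x hx
  have h' := congrArg (fun S : NonUnitalStarSubalgebra ℂ _ => (S : Set (lp (fun R : G.RelCKRep 𝓔 => R.carrier) ∞))) h
  change Subtype.val '' (NonUnitalStarAlgebra.adjoin ℂ (Set.range (RelCKAlgebra.gen G 𝓔)) :
    Set (G.RelCKAlgebra 𝓔)) = _ at h'
  exact (congrArg closure h').ge hx

end KGraph

open KGraph in
theorem lemma8p2 {k : ℕ} (hk : 0 < k) {Λ : Type u} [Category.{v} Λ] (G : KGraph k Λ)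
    (hG : G.FinitelyAligned) (𝓔 : Set (Finset (Mor Λ))) (h𝓔 : 𝓔 ⊆ G.FE)
    (b : Λ → (Fin k → ℤ))
    (hb : ∀ (p : Mor Λ) (i : Fin k), (G.d p i : ℤ) = b p.s i - b p.r i) :
    IsAF (G.RelCKAlgebra 𝓔) := by
  have ht := RelCKAlgebra.isRelCKFamily_gen G hG 𝓔 h𝓔
  have := G.countable
  obtain ⟨f, hf⟩ := exists_injective_nat (Mor Λ)
  let F : ℕ → Set (Mor Λ) := fun n => {p | f p ≤ n}
  have hF : Monotone F := fun m n h p hp => le_trans hp h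
  let A := fun n => G.closureSubalgebra hG ht (F n)
  have hA : Monotone A := (closureSubalgebra_mono hG ht).comp hF
  refine ⟨A, hA, fun n => closureSubalgebra_finiteDimensional hG ht
    (ExtClosure.finite hG hb ((Set.finite_Iic n).preimage hf.injOn)), ?_⟩
  refine (RelCKAlgebra.dense_adjoin_gen G 𝓔).mono ?_
  have hsup : NonUnitalStarAlgebra.adjoin ℂ (Set.range (RelCKAlgebra.gen G 𝓔)) ≤ ⨆ n, A n := by
    refine NonUnitalStarAlgebra.adjoin_le ?_
    rintro _ ⟨p, rfl⟩
    let n := max (f p) (f (Mor.idMor p.s))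
    exact le_iSup A n (mem_closureSubalgebra hG ht (F := F n) (le_max_left (f p) _)
      (le_max_right _ (f (Mor.idMor p.s))))
  rw [← NonUnitalStarSubalgebra.coe_iSup_of_directed hA.directed_le]
  exact hsup
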